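/- **Testing rules.** For $x\in\mathbb R^n$ and an integer $k\ge 0$, let $I_k(x)\subseteq[n]$ be the top-$k$ set: $I_0(x)=\emptyset$, and for $1\le k\le n$, $I_k(x)$ consists of all $i$ such that $x_i$ is at least the $k$-th largest coordinate of $x$ ($I_k(x)=[n]$ for $k>n$). A top-$K$ procedure observes $X\in\mathbb R^n$, chooses a nonnegative integer $K$ as a measurable, possibly randomized, function of $X$, and declares the discoveries $I=I_K(X)$. If $\mathcal H_1\subseteq[n]$ is the set of signals and $\mathcal H_0=[n]\setminus\mathcal H_1$ the set of nulls, then $$\mathrm{FDR}=\mathbb E\Big[\frac{|I\cap\mathcal H_0|}{|I|\vee 1}\Big],\qquad \mathrm{FNR}=\mathbb E\Big[\frac{|I^c\cap\mathcal H_1|}{|\mathcal H_1|}\Big].$$ A procedure is $(\alpha,\beta)$-controlled if $\mathrm{FDR}\le\alpha$ and $\mathrm{FNR}\le\beta$. **Grouped dependence Gaussian location model** with parameters $(n,m,A,\mu)$. There are $m$ signals $\mathcal H_1=\{i_1<\dots<i_m\}\subseteq[n]$ and pairwise disjoint sets of nulls $\mathcal H_0^{(1)},\dots,\mathcal H_0^{(m)}\subseteq\mathcal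 H_0$, each of cardinality $A$. The variables $W_i$, for $i\in\mathcal H_1$ or $i\in\mathcal H_0\setminus\bigcup_g\mathcal H_0^{(g)}$, are i.i.d. $\mathcal N(0,1)$, and $W_i=W_{i_g}$ for $i\in\mathcal H_0^{(g)}$. One observes $X_i=W_i$ for $i\in\mathcal H_0$ and $X_i=W_i+\mu$ for $i\in\mathcal H_1$. **Corollary.** Let $0\le t<s<r<1$. For $n\ge1$ let $m_n$ and $A_n$ be nonnegative integers equal to $n^{1-s}$ and $(n-m_n)/n^{1-t}$ up to rounding, that is, $|m_n-n^{1-s}|<1$ and $|A_n-(n-m_n)/n^{1-t}|<1$, and let $\mu_n=\sqrt{2r\log n}$. Let $c>0$ and $\kappa_\alpha,\kappa_\beta\in\mathbb R$, and put $\alpha_n=c\,n^{-\kappa_\alpha}$, $\beta_n=c\,n^{-\kappa_\beta}$. Suppose that for all sufficiently large $n$ we have $\alpha_n<1$ and $\beta_n<1$ (so that in particular $\kappa_\alpha,\kappa_\beta\ge0$), and that in the grouped dependence Gaussian location model with parameters $(n,m_n,A_n,\mu_n)$, for some choice of the signals and groups, there is an $(\alpha_n,\beta_n)$-controlled top-$K$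 procedure. Then $$\sqrt{s+\kappa_\alpha}+\sqrt{\kappa_\beta}\le\sqrt r .$$ -/

import Mathlib

open MeasureTheory ProbabilityTheory

noncomputable section

/-- The combinatorial layout of the grouped dependence model on the index set `[n]`:
signals `i_1 < ⋯ < i_m`, and for each `g` a set of `A` nulls attached to the `g`-th signal,
distinct signals having disjoint sets of nulls. -/
structure GroupedDesign (n m A : ℕ) where
  /-- `sig g` is the index of the `g`-th signal. -/
  sig : Fin m ↪o Fin n
  /-- `group g` is the set of nulls that copy the `g`-th signal. -/
  group : Fin m → Finset (Fin n)
  card_group : ∀ g, (group g).card = A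
  disjoint_group : ∀ g h, g ≠ h → Disjoint (group g) (group h)
  sig_notMem_group : ∀ g h, sig h ∉ group g

namespace GroupedDesign

variable {n m A : ℕ} (D : GroupedDesign n m A)

/-- The set of signals. -/
def signals : Finset (Fin n) := Finset.univ.map D.sig.toEmbedding

/-- The set of nulls. -/
def nulls : Finset (Fin n) := D.signalsᶜ

open Classical in
/-- The index of the independent Gaussian that drives coordinate `i`: the `g`-th signal if `i` is
a null of the `g`-th group, and `i` itself if `i` is a signal or a null outside all groups. -/
def source (i : Fin n) : Fin n :=
  if h : ∃ g, i ∈ D.group g then D.sig h.choose else i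

/-- The law of `W`: signals and nulls outside all groups are i.i.d. standard Gaussian, and
every null of the `g`-th group is equal to the `g`-th signal's `W`. -/
def baseLaw : Measure (Fin n → ℝ) :=
  (Measure.pi fun _ : Fin n => gaussianReal 0 1).map fun z i => z (D.source i)

/-- `X_i = W_i` on nulls, `X_i = W_i + μ` on signals. -/
def locationShift (μ : ℝ) (w : Fin n → ℝ) : Fin n → ℝ :=
  fun i => if i ∈ D.signals then w i + μ else w i

/-- The law of the vector `X` of test statistics in the location model with shift `μ`. -/
def statLaw (μ : ℝ) : Measure (Fin n → ℝ) := D.baseLaw.map (D.locationShift μ)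

/-- False discovery proportion of a set of discoveries. -/
def fdp (R : Finset (Fin n)) : ℝ := ((R ∩ D.nulls).card : ℝ) / (max R.card 1 : ℕ)

/-- False non-discovery proportion of a set of discoveries. -/
def fnp (R : Finset (Fin n)) : ℝ := ((Rᶜ ∩ D.signals).card : ℝ) / (D.signals.card : ℝ)

end GroupedDesign

/-- The discoveries of the top-`k` rule: those `i` such that fewer than `k` coordinates of `x`
are strictly larger than `x i`. For `1 ≤ k ≤ n` this is the set of `i` such that `x i` is at least
the `k`-th largest coordinate (see `mem_topK_iff`); for `k = 0` it is empty. -/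
def topK {n : ℕ} (x : Fin n → ℝ) (k : ℕ) : Finset (Fin n) :=
  {i | (Finset.univ.filter fun j => x i < x j).card < k}

/-- `topK` in terms of the increasing rearrangement `x ∘ Tuple.sort x`, whose entry with
(zero-based) index `n - k` is the `k`-th largest coordinate. -/
theorem mem_topK_iff {n : ℕ} (x : Fin n → ℝ) (k : ℕ) (hk : 1 ≤ k) (hkn : k ≤ n) (i : Fin n) :
    i ∈ topK x k ↔ x (Tuple.sort x ⟨n - k, by omega⟩) ≤ x i := by
  have hmono : Monotone (x ∘ Tuple.sort x) := Tuple.monotone_sort x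
  have hcard : (Finset.univ.filter fun j => x i < x j).card
      = (Finset.univ.filter fun a => x i < x (Tuple.sort x a)).card := by
    symm
    apply Finset.card_bij (fun a _ => Tuple.sort x a)
    · intro a ha; simpa using ha
    · intro a _ b _ h; exact (Tuple.sort x).injective h
    · intro b hb; exact ⟨(Tuple.sort x).symm b, by simpa using hb, by simp⟩
  unfold topK
  rw [Finset.mem_filter, hcard]
  simp only [Finset.mem_univ, true_and]
  constructor
  · intro h
    by_contra! hlt
    have hsub : Finset.Ici (⟨n - k, by omega⟩ : Fin n)
        ⊆ Finset.univ.filter fun a => x i < x (Tuple.sort x a) := by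
      intro a ha
      rw [Finset.mem_Ici] at ha
      simpa using lt_of_lt_of_le hlt (hmono ha)
    have := Finset.card_le_card hsub
    rw [Fin.card_Ici] at this
    simp only at this
    omega
  · intro h
    have hsub : (Finset.univ.filter fun a => x i < x (Tuple.sort x a))
        ⊆ Finset.Ioi (⟨n - k, by omega⟩ : Fin n) := by
      intro a ha
      rw [Finset.mem_Ioi]
      by_contra! hle
      have h1 : x (Tuple.sort x a) ≤ x (Tuple.sort x ⟨n - k, by omega⟩) := hmono hle
      have h2 : x i < x (Tuple.sort x a) := by simpa using ha
      linarith
    have := Finset.card_le_card hsub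
    rw [Fin.card_Ioi] at this
    simp only at this
    omega

namespace GroupedDesign

variable {n m A : ℕ} (D : GroupedDesign n m A)

/-- `FDR` in the location model with shift `μ` of the top-`K` procedure given by `K`. A (possibly
randomized) choice of `K` from the data is a Markov kernel from `ℝⁿ` to `ℕ`; the expectation is
over the joint law of `(X, K)`. -/
def FDR (μ : ℝ) (K : Kernel (Fin n → ℝ) ℕ) : ℝ :=
  ∫ p, D.fdp (topK p.1 p.2) ∂(D.statLaw μ ⊗ₘ K)

/-- `FNR` in the location model with shift `μ` of the top-`K` procedure given by `K`. -/
def FNR (μ : ℝ) (K : Kernel (Fin n → ℝ) ℕ) : ℝ :=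
  ∫ p, D.fnp (topK p.1 p.2) ∂(D.statLaw μ ⊗ₘ K)

/-- Some (possibly randomized) top-`K` procedure is `(α, β)`-controlled in the location model
with shift `μ`. -/
def Achievable (μ α β : ℝ) : Prop :=
  ∃ K : Kernel (Fin n → ℝ) ℕ, IsMarkovKernel K ∧ D.FDR μ K ≤ α ∧ D.FNR μ K ≤ β

end GroupedDesign

end

/-! Fix a threshold `T`. A top-`k` set either contains every coordinate that is at least `T`, or
only coordinates above `T` (`topK_dichotomy`). In the first case every free null (a null outside all
groups) reaching `T` is a false discovery; in the second every signal below `T` is missed. With `N`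
such nulls and `S` such signals, this forces `fdp ≥ N / (N + m)` or `fnp ≥ S / m`, whatever the
choice of `k`. Signals and free nulls are driven by independent coordinates, so Chebyshev keeps `N`
and `S` near their means, and averaging bounds the error rates of every procedure
(`one_le_of_achievable_gaussian`). The grouped nulls are simply discarded: since `t < s` there are
only `o(n)` of them.

Take `T = x √(2 log n) - 1`. Up to constants `N` is at least `n ^ (1 - x²)` while `m` is about `n ^
(1 - s)`, so the term `α m / N` vanishes when `x² < s + κα`. A signal misses `T` with probability at
least about `n ^ (-y²)` for any positive `y > √r - x`, so the term `β m / S` vanishes when some such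
`y` has `y² < κβ`. If `√(s + κα) + √κβ > √r`, suitable `x` and `y` exist, and for `κβ > 0` the limit
reads `1 ≤ lim α < 1`. For `κβ = 0`, `x > √r` makes almost all signals miss `T`, which contradicts
`β = c < 1`. -/

open Filter Topology

/-! ### Concentration of counts and a Gaussian mass bound. -/

/-- Chebyshev lower-tail bound for the number of coordinates, within a finite set `J`, at which a
product of identical laws falls into `B`. -/
theorem measureReal_pi_card_filter_lt_le {ι : Type*} [Fintype ι] (ν : Measure ℝ)
    [IsProbabilityMeasure ν] (J : Finset ι) {B : Set ℝ} (hB : MeasurableSet B)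
    [DecidablePred (· ∈ B)] {δ : ℝ} (hδ : 0 < δ) (hpos : 0 < J.card * ν.real B) :
    (Measure.pi fun _ : ι => ν).real
        {z | ((J.filter fun i => z i ∈ B).card : ℝ) < (1 - δ) * (J.card * ν.real B)}
      ≤ 1 / (δ ^ 2 * (J.card * ν.real B)) := by
  set P := Measure.pi fun _ : ι => ν
  set Y : ι → (ι → ℝ) → ℝ := fun i z => B.indicator 1 (z i)
  have hind : Measurable (B.indicator (1 : ℝ → ℝ)) := measurable_one.indicator hB
  have hYm : ∀ i, Measurable (Y i) := fun i => hind.comp (measurable_pi_apply i)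
  have hY0 : ∀ i z, 0 ≤ Y i z := fun i z => Set.indicator_nonneg (fun _ _ => zero_le_one) _
  have hY1 : ∀ i z, Y i z ≤ 1 := fun i z =>
    Set.indicator_le_self' (fun _ _ => zero_le_one) (z i)
  have hY2 : ∀ i, MemLp (Y i) 2 P := fun i =>
    MemLp.of_bound (hYm i).aestronglyMeasurable 1 <| ae_of_all _ fun z => by
      rw [Real.norm_eq_abs, abs_of_nonneg (hY0 i z)]; exact hY1 i z
  have hEY : ∀ i, ∫ z, Y i z ∂P = ν.real B := fun i => by
    have : ∫ z, Y i z ∂P = ∫ x, B.indicator (1 : ℝ → ℝ) x ∂ν := by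
      rw [← (measurePreserving_eval (fun _ : ι => ν) i).map_eq,
        integral_map (measurable_pi_apply i).aemeasurable hind.aestronglyMeasurable]
    rw [this, integral_indicator_one hB]
  have hYsq : ∀ i, Y i ^ 2 = Y i := fun i => by
    ext z
    by_cases h : z i ∈ B <;> simp [Y, h]
  -- An idempotent variable has variance at most its mean; hence the final bound is the reciprocal
  -- of the expected count.
  have hvar : ∀ i, Var[Y i; P] ≤ ν.real B := fun i => by
    refine (variance_le_expectation_sq (hYm i).aestronglyMeasurable).trans ?_
    rw [hYsq i, hEY i]
  have hindep : iIndepFun Y P := iIndepFun_pi (X := fun _ x => B.indicator (1 : ℝ → ℝ) x)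
    fun _ => hind.aemeasurable
  have hS2 : MemLp (∑ i ∈ J, Y i) 2 P := memLp_finsetSum' _ fun i _ => hY2 i
  have hES : ∫ z, (∑ i ∈ J, Y i) z ∂P = J.card * ν.real B := by
    simp only [Finset.sum_apply]
    rw [integral_finsetSum _ fun i _ => (hY2 i).integrable (by norm_num)]
    simp [hEY]
  have hVS : Var[∑ i ∈ J, Y i; P] ≤ J.card * ν.real B := by
    rw [IndepFun.variance_sum (fun i _ => hY2 i) fun i _ j _ hij => hindep.indepFun hij]
    refine (Finset.sum_le_sum fun i _ => hvar i).trans ?_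
    simp
  have hcount : ∀ z, (∑ i ∈ J, Y i) z = ((J.filter fun i => z i ∈ B).card : ℝ) := fun z => by
    simp [Finset.sum_apply, Y, Set.indicator_apply]
  have hc : 0 < δ * (J.card * ν.real B) := by positivity
  have hcheb := meas_ge_le_variance_div_sq hS2 hc
  rw [hES] at hcheb
  have hsub : {z | ((J.filter fun i => z i ∈ B).card : ℝ) < (1 - δ) * (J.card * ν.real B)}
      ⊆ {z | δ * (J.card * ν.real B) ≤ |(∑ i ∈ J, Y i) z - J.card * ν.real B|} := by
    intro z hz
    simp only [Set.mem_ofPred_eq] at hz ⊢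
    rw [hcount, abs_sub_comm]
    refine le_trans ?_ (le_abs_self _)
    linarith
  refine (measureReal_mono hsub).trans ?_
  refine (ENNReal.toReal_mono ENNReal.ofReal_ne_top hcheb).trans ?_
  rw [ENNReal.toReal_ofReal (by positivity [variance_nonneg (∑ i ∈ J, Y i) P])]
  calc Var[∑ i ∈ J, Y i; P] / (δ * (J.card * ν.real B)) ^ 2
      ≤ (J.card * ν.real B) / (δ * (J.card * ν.real B)) ^ 2 := by gcongr
    _ = 1 / (δ ^ 2 * (J.card * ν.real B)) := by field_simp

/-- A unit interval inside `[-w, w]` has standard Gaussian mass at least the density at `w`. -/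
theorem le_measureReal_gaussianReal_Ico {w a : ℝ} (h1 : -w ≤ a) (h2 : a + 1 ≤ w) :
    (√(2 * Real.pi))⁻¹ * Real.exp (-(w ^ 2) / 2) ≤ (gaussianReal 0 1).real (Set.Ico a (a + 1)) := by
  rw [measureReal_def, gaussianReal_apply_eq_integral 0 one_ne_zero,
    ENNReal.toReal_ofReal (setIntegral_nonneg measurableSet_Ico
      fun x _ => gaussianPDFReal_nonneg 0 1 x)]
  have hle : ∀ x ∈ Set.Ico a (a + 1),
      (√(2 * Real.pi))⁻¹ * Real.exp (-(w ^ 2) / 2) ≤ gaussianPDFReal 0 1 x := by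
    intro x hx
    simp only [gaussianPDFReal, NNReal.coe_one, mul_one, sub_zero]
    have : x ^ 2 ≤ w ^ 2 := sq_le_sq' (by linarith [hx.1]) (by linarith [hx.2])
    gcongr
  have := setIntegral_ge_of_const_le measurableSet_Ico (by simp) hle
    (integrable_gaussianPDFReal 0 1).integrableOn
  simpa using this

/-! ### Measurability and threshold structure of top-`k` sets. -/

theorem measurableSet_mem_topK {n : ℕ} (i : Fin n) :
    MeasurableSet {p : (Fin n → ℝ) × ℕ | i ∈ topK p.1 p.2} := by
  have h : Measurable fun p : (Fin n → ℝ) × ℕ =>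
      (Finset.univ.filter fun j => p.1 i < p.1 j).card := by
    simp only [Finset.card_filter]
    refine Finset.measurable_sum _ fun j _ => Measurable.ite ?_ measurable_const measurable_const
    exact measurableSet_lt ((measurable_pi_apply i).comp measurable_fst)
      ((measurable_pi_apply j).comp measurable_fst)
  simpa [topK] using measurableSet_lt h measurable_snd

/-- Every real function of the discoveries of a top-`K` rule is measurable. -/
theorem measurable_comp_topK {n : ℕ} (f : Finset (Fin n) → ℝ) :
    Measurable fun p : (Fin n → ℝ) × ℕ => f (topK p.1 p.2) := by
  have hsingle : ∀ R : Finset (Fin n),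
      MeasurableSet {p : (Fin n → ℝ) × ℕ | topK p.1 p.2 = R} := by
    intro R
    have : {p : (Fin n → ℝ) × ℕ | topK p.1 p.2 = R}
        = ⋂ i, {p | i ∈ topK p.1 p.2 ↔ i ∈ R} := by
      ext p; simp [Finset.ext_iff]
    rw [this]
    exact MeasurableSet.iInter fun i => (measurableSet_mem_topK i).iff (MeasurableSet.const _)
  intro s _
  have : (fun p : (Fin n → ℝ) × ℕ => f (topK p.1 p.2)) ⁻¹' s
      = ⋃ R ∈ {R | f R ∈ s}, {p : (Fin n → ℝ) × ℕ | topK p.1 p.2 = R} := by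
    ext p; simp
  rw [this]
  exact MeasurableSet.biUnion (Set.to_countable _) fun R _ => hsingle R

theorem integrable_comp_topK {n : ℕ} (f : Finset (Fin n) → ℝ)
    (P : Measure ((Fin n → ℝ) × ℕ)) [IsFiniteMeasure P] :
    Integrable (fun p => f (topK p.1 p.2)) P := by
  refine Integrable.of_bound (measurable_comp_topK f).aestronglyMeasurable
    (∑ R, ‖f R‖) (ae_of_all _ fun p => ?_)
  exact Finset.single_le_sum (f := fun R => ‖f R‖) (fun _ _ => norm_nonneg _) (Finset.mem_univ _)

/-- A top-`k` set contains every coordinate that is at least `T`, or only coordinates above `T`. -/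
theorem topK_dichotomy {n : ℕ} (x : Fin n → ℝ) (k : ℕ) (T : ℝ) :
    (∀ i, T ≤ x i → i ∈ topK x k) ∨ ∀ i ∈ topK x k, T < x i := by
  by_contra! h
  obtain ⟨⟨j, hj, hjk⟩, i, hi, hiT⟩ := h
  apply hjk
  simp only [topK, Finset.mem_filter, Finset.mem_univ, true_and] at hi ⊢
  -- Since `x i ≤ T ≤ x j`, whatever exceeds `x j` also exceeds `x i`, so `j` passes the rank test
  -- that `i` passes.
  refine lt_of_le_of_lt (Finset.card_le_card fun l hl => ?_) hi
  simp only [Finset.mem_filter, Finset.mem_univ, true_and] at hl ⊢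
  linarith

/-! ### Model layout and the pointwise tradeoff at a threshold. -/

namespace GroupedDesign

variable {n m A : ℕ} (D : GroupedDesign n m A)

/-- The nulls outside all groups. -/
def freeNulls : Finset (Fin n) := D.nulls \ Finset.univ.biUnion D.group

theorem card_signals : D.signals.card = m := by simp [signals]

theorem card_freeNulls : D.freeNulls.card = n - m - m * A := by
  have hsub : Finset.univ.biUnion D.group ⊆ D.nulls := by
    intro i hi
    simp only [Finset.mem_biUnion, Finset.mem_univ, true_and] at hi
    obtain ⟨g, hg⟩ := hi
    simp only [nulls, signals, Finset.mem_compl, Finset.mem_map, Finset.mem_univ, true_and]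
    rintro ⟨h, rfl⟩
    exact D.sig_notMem_group g h hg
  rw [freeNulls, Finset.card_sdiff_of_subset hsub, nulls, Finset.card_compl, card_signals,
    Finset.card_biUnion fun g _ h _ hgh => D.disjoint_group g h hgh]
  simp [D.card_group]

theorem source_eq_self {i : Fin n} (h : ∀ g, i ∉ D.group g) : D.source i = i := by
  rw [source, dif_neg (by simpa using h)]

theorem source_of_mem_freeNulls {i : Fin n} (h : i ∈ D.freeNulls) : D.source i = i := by
  refine D.source_eq_self fun g hg => ?_
  simp only [freeNulls, Finset.mem_sdiff, Finset.mem_biUnion, Finset.mem_univ, true_and] at h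
  exact h.2 ⟨g, hg⟩

theorem source_of_mem_signals {i : Fin n} (h : i ∈ D.signals) : D.source i = i := by
  simp only [signals, Finset.mem_map, Finset.mem_univ, true_and] at h
  obtain ⟨g, rfl⟩ := h
  exact D.source_eq_self fun h => D.sig_notMem_group h g

theorem measurable_locationShift (μ : ℝ) : Measurable (D.locationShift μ) := by
  refine measurable_pi_lambda _ fun i => ?_
  by_cases h : i ∈ D.signals
  · simpa [locationShift, h] using (measurable_pi_apply (X := fun _ => ℝ) i).add_const μ
  · simpa [locationShift, h] using measurable_pi_apply i

theorem measurable_source : Measurable fun (z : Fin n → ℝ) i => z (D.source i) :=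
  measurable_pi_lambda _ fun i => measurable_pi_apply (D.source i)

theorem statLaw_eq (μ : ℝ) : D.statLaw μ = (Measure.pi fun _ : Fin n => gaussianReal 0 1).map
    fun z => D.locationShift μ fun i => z (D.source i) := by
  rw [statLaw, baseLaw, Measure.map_map (D.measurable_locationShift μ) D.measurable_source]
  rfl

theorem measureReal_statLaw_apply (μ : ℝ) {B : Set (Fin n → ℝ)} (hB : MeasurableSet B) :
    (D.statLaw μ).real B = (Measure.pi fun _ : Fin n => gaussianReal 0 1).real
      {z | (D.locationShift μ fun i => z (D.source i)) ∈ B} := by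
  rw [statLaw_eq]
  exact map_measureReal_apply ((D.measurable_locationShift μ).comp D.measurable_source) hB

instance (μ : ℝ) : IsProbabilityMeasure (D.statLaw μ) := by
  rw [statLaw_eq]
  exact Measure.isProbabilityMeasure_map
    ((D.measurable_locationShift μ).comp D.measurable_source).aemeasurable

theorem fdp_nonneg (R : Finset (Fin n)) : 0 ≤ D.fdp R := by unfold fdp; positivity

theorem fnp_nonneg (R : Finset (Fin n)) : 0 ≤ D.fnp R := by unfold fnp; positivity

/-- The number of free nulls that reach the threshold `T`. -/
noncomputable def nullCount (T : ℝ) (x : Fin n → ℝ) : ℕ := (D.freeNulls.filter fun i => T ≤ x i).card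

/-- The number of signals below the threshold `T`. -/
noncomputable def missCount (T : ℝ) (x : Fin n → ℝ) : ℕ := (D.signals.filter fun i => x i < T).card

/-- Every top-`k` set suffers a large false discovery or a large false non-discovery proportion
when many free nulls reach a threshold and many signals miss it. -/
theorem one_le_fdp_div_add_fnp_div {T N₀ S₀ : ℝ} (hN₀ : 0 < N₀) (hS₀ : 0 < S₀) (hm : 0 < m)
    {x : Fin n → ℝ} (hN : N₀ ≤ D.nullCount T x) (hS : S₀ ≤ D.missCount T x) (k : ℕ) :
    1 ≤ D.fdp (topK x k) * (1 + m / N₀) + D.fnp (topK x k) * (m / S₀) := by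
  have hm' : (0 : ℝ) < m := by exact_mod_cast hm
  have hfd := D.fdp_nonneg (topK x k)
  have hfn := D.fnp_nonneg (topK x k)
  set R := topK x k with hR
  rcases topK_dichotomy x k T with h | h
  · have hsub : D.freeNulls.filter (fun i => T ≤ x i) ⊆ R ∩ D.nulls := by
      intro i hi
      simp only [Finset.mem_filter, freeNulls, Finset.mem_sdiff] at hi
      exact Finset.mem_inter.2 ⟨h i hi.2, hi.1.1⟩
    have ha : N₀ ≤ ((R ∩ D.nulls).card : ℝ) :=
      hN.trans (by exact_mod_cast Finset.card_le_card hsub)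
    -- Discoveries that are not null are signals, so there are at most `m` of them.
    have hcard : R.card ≤ (R ∩ D.nulls).card + m := by
      have h1 := Finset.card_inter_add_card_sdiff R D.nulls
      have h2 : (R \ D.nulls).card ≤ D.signals.card := Finset.card_le_card fun i hi => by
        simpa [nulls] using (Finset.mem_sdiff.1 hi).2
      rw [D.card_signals] at h2
      omega
    have hmax : ((max R.card 1 : ℕ) : ℝ) ≤ (R ∩ D.nulls).card + m := by
      exact_mod_cast max_le hcard (by omega)
    have hmaxpos : (0 : ℝ) < (max R.card 1 : ℕ) := by exact_mod_cast (by omega)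
    have : 1 ≤ D.fdp R * (1 + m / N₀) := by
      rw [fdp, div_mul_eq_mul_div, one_le_div hmaxpos]
      refine hmax.trans ?_
      -- With `a` false discoveries, `a ≥ N₀` gives `a + m ≤ a (1 + m / N₀)`.
      have : (m : ℝ) ≤ (R ∩ D.nulls).card * (m / N₀) := by
        rw [← mul_div_assoc, le_div_iff₀ hN₀, mul_comm]
        gcongr
      linarith
    have : 0 ≤ D.fnp R * (m / S₀) := by positivity
    linarith
  · have hsub : D.signals.filter (fun i => x i < T) ⊆ Rᶜ ∩ D.signals := by
      intro i hi
      simp only [Finset.mem_filter] at hi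
      refine Finset.mem_inter.2 ⟨Finset.mem_compl.2 fun hiR => ?_, hi.1⟩
      linarith [h i hiR, hi.2]
    have hb : S₀ ≤ ((Rᶜ ∩ D.signals).card : ℝ) :=
      hS.trans (by exact_mod_cast Finset.card_le_card hsub)
    have : 1 ≤ D.fnp R * (m / S₀) := by
      rw [fnp, card_signals, div_mul_div_cancel₀ hm'.ne', one_le_div hS₀]
      exact hb
    have : 0 ≤ D.fdp R * (1 + m / N₀) := by positivity
    linarith

theorem measurable_nullCount (T : ℝ) : Measurable (D.nullCount T) := by
  unfold nullCount
  simp only [Finset.card_filter]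
  exact Finset.measurable_sum _ fun i _ => Measurable.ite
    (measurableSet_le measurable_const (measurable_pi_apply i)) measurable_const measurable_const

theorem measurable_missCount (T : ℝ) : Measurable (D.missCount T) := by
  unfold missCount
  simp only [Finset.card_filter]
  exact Finset.measurable_sum _ fun i _ => Measurable.ite
    (measurableSet_lt (measurable_pi_apply i) measurable_const) measurable_const measurable_const

theorem measurableSet_nullCount_lt (T a : ℝ) : MeasurableSet {x | (D.nullCount T x : ℝ) < a} :=
  measurableSet_lt (measurable_from_top.comp (D.measurable_nullCount T)) measurable_const

theorem measurableSet_missCount_lt (T a : ℝ) : MeasurableSet {x | (D.missCount T x : ℝ) < a} :=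
  measurableSet_lt (measurable_from_top.comp (D.measurable_missCount T)) measurable_const

end GroupedDesign

/-! ### Error rates of a procedure at fixed `n`. -/

namespace GroupedDesign

variable {n m A : ℕ} (D : GroupedDesign n m A)

theorem measureReal_statLaw_nullCount_lt_le (μ T : ℝ) {δ : ℝ} (hδ : 0 < δ)
    (hpos : 0 < D.freeNulls.card * (gaussianReal 0 1).real (Set.Ici T)) :
    (D.statLaw μ).real {x | (D.nullCount T x : ℝ)
        < (1 - δ) * (D.freeNulls.card * (gaussianReal 0 1).real (Set.Ici T))}
      ≤ 1 / (δ ^ 2 * (D.freeNulls.card * (gaussianReal 0 1).real (Set.Ici T))) := by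
  classical
  refine le_trans (le_of_eq ?_) (measureReal_pi_card_filter_lt_le (gaussianReal 0 1) D.freeNulls
    measurableSet_Ici hδ hpos)
  rw [D.measureReal_statLaw_apply μ (D.measurableSet_nullCount_lt T _)]
  congr 1
  ext z
  have : D.nullCount T (D.locationShift μ fun i => z (D.source i))
      = (D.freeNulls.filter fun i => z i ∈ Set.Ici T).card := by
    unfold nullCount
    congr 1
    refine Finset.filter_congr fun i hi => ?_
    -- A free null is neither shifted nor a copy, so its statistic is its own independent
    -- coordinate.
    have hns : i ∉ D.signals := by
      simp only [freeNulls, nulls, Finset.mem_sdiff, Finset.mem_compl] at hi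
      exact hi.1
    simp [locationShift, hns, D.source_of_mem_freeNulls hi]
  simp [this]

theorem measureReal_statLaw_missCount_lt_le (μ T : ℝ) {δ : ℝ} (hδ : 0 < δ)
    (hpos : 0 < m * (gaussianReal 0 1).real (Set.Iio (T - μ))) :
    (D.statLaw μ).real {x | (D.missCount T x : ℝ)
        < (1 - δ) * (m * (gaussianReal 0 1).real (Set.Iio (T - μ)))}
      ≤ 1 / (δ ^ 2 * (m * (gaussianReal 0 1).real (Set.Iio (T - μ)))) := by
  classical
  have key := measureReal_pi_card_filter_lt_le (gaussianReal 0 1) D.signals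
    (measurableSet_Iio (a := T - μ)) hδ (by rwa [card_signals])
  rw [card_signals] at key
  refine le_trans (le_of_eq ?_) key
  rw [D.measureReal_statLaw_apply μ (D.measurableSet_missCount_lt T _)]
  congr 1
  ext z
  have : D.missCount T (D.locationShift μ fun i => z (D.source i))
      = (D.signals.filter fun i => z i ∈ Set.Iio (T - μ)).card := by
    unfold missCount
    congr 1
    refine Finset.filter_congr fun i hi => ?_
    simp [locationShift, hi, D.source_of_mem_signals hi, lt_sub_iff_add_lt]
  simp [this]

/-- Averaging `one_le_fdp_div_add_fnp_div`: a lower bound on the error rates of any top-`K`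
procedure, up to the probability that the counts at threshold `T` are small. -/
theorem one_le_of_achievable {μ α β : ℝ} (h : D.Achievable μ α β) (T : ℝ) {N₀ S₀ : ℝ}
    (hN₀ : 0 < N₀) (hS₀ : 0 < S₀) (hm : 0 < m) :
    1 ≤ α * (1 + m / N₀) + β * (m / S₀)
      + (D.statLaw μ).real {x | (D.nullCount T x : ℝ) < N₀}
      + (D.statLaw μ).real {x | (D.missCount T x : ℝ) < S₀} := by
  obtain ⟨K, hK, hFDR, hFNR⟩ := h
  set P := D.statLaw μ ⊗ₘ K
  set B₁ : Set (Fin n → ℝ) := {x | (D.nullCount T x : ℝ) < N₀}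
  set B₂ : Set (Fin n → ℝ) := {x | (D.missCount T x : ℝ) < S₀}
  have hB₁ : MeasurableSet B₁ := D.measurableSet_nullCount_lt T _
  have hB₂ : MeasurableSet B₂ := D.measurableSet_missCount_lt T _
  have hmarg : ∀ B : Set (Fin n → ℝ), MeasurableSet B →
      ∫ p, (Prod.fst ⁻¹' B).indicator 1 p ∂P = (D.statLaw μ).real B := fun B hB => by
    rw [integral_indicator_one (measurable_fst hB), ← map_measureReal_apply measurable_fst hB]
    change P.fst.real B = _
    rw [Measure.fst_compProd]
  have hint : ∀ B : Set (Fin n → ℝ), MeasurableSet B →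
      Integrable ((Prod.fst ⁻¹' B).indicator (1 : (Fin n → ℝ) × ℕ → ℝ)) P := fun B hB =>
    (integrable_const (1 : ℝ)).indicator (measurable_fst hB)
  -- On the bad events an indicator already supplies the `1`; off them the pointwise tradeoff does.
  have hpt : ∀ p : (Fin n → ℝ) × ℕ, (1 : ℝ) ≤ D.fdp (topK p.1 p.2) * (1 + m / N₀)
      + D.fnp (topK p.1 p.2) * (m / S₀) + (Prod.fst ⁻¹' B₁).indicator 1 p
      + (Prod.fst ⁻¹' B₂).indicator 1 p := by
    intro p
    have h1 : (0 : ℝ) ≤ (Prod.fst ⁻¹' B₁).indicator 1 p :=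
      Set.indicator_nonneg (fun _ _ => zero_le_one) _
    have h2 : (0 : ℝ) ≤ (Prod.fst ⁻¹' B₂).indicator 1 p :=
      Set.indicator_nonneg (fun _ _ => zero_le_one) _
    have hfd : 0 ≤ D.fdp (topK p.1 p.2) * (1 + m / N₀) :=
      mul_nonneg (D.fdp_nonneg _) (by positivity)
    have hfn : 0 ≤ D.fnp (topK p.1 p.2) * (m / S₀) :=
      mul_nonneg (D.fnp_nonneg _) (by positivity)
    by_cases hp1 : p.1 ∈ B₁
    · have : (Prod.fst ⁻¹' B₁).indicator (1 : (Fin n → ℝ) × ℕ → ℝ) p = 1 := by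
        simp [hp1]
      linarith
    by_cases hp2 : p.1 ∈ B₂
    · have : (Prod.fst ⁻¹' B₂).indicator (1 : (Fin n → ℝ) × ℕ → ℝ) p = 1 := by
        simp [hp2]
      linarith
    have := D.one_le_fdp_div_add_fnp_div hN₀ hS₀ hm (not_lt.1 hp1) (not_lt.1 hp2) p.2
    linarith
  have hi1 := (integrable_comp_topK D.fdp P).mul_const (1 + m / N₀)
  have hi2 := (integrable_comp_topK D.fnp P).mul_const (m / S₀)
  have hmono := integral_mono (integrable_const (1 : ℝ))
    (((hi1.add hi2).add (hint B₁ hB₁)).add (hint B₂ hB₂)) hpt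
  rw [integral_add' ((hi1.add hi2).add (hint B₁ hB₁)) (hint B₂ hB₂),
    integral_add' (hi1.add hi2) (hint B₁ hB₁), integral_add' hi1 hi2,
    hmarg B₁ hB₁, hmarg B₂ hB₂, integral_mul_const, integral_mul_const] at hmono
  simp only [integral_const, probReal_univ, smul_eq_mul, mul_one] at hmono
  have e1 : (∫ p, D.fdp (topK p.1 p.2) ∂P) * (1 + m / N₀) ≤ α * (1 + m / N₀) := by
    gcongr; exact hFDR
  have e2 : (∫ p, D.fnp (topK p.1 p.2) ∂P) * (m / S₀) ≤ β * (m / S₀) := by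
    gcongr; exact hFNR
  linarith

/-- The error rates of every top-`K` procedure against the Gaussian tail probabilities at a
threshold `T`. -/
theorem one_le_of_achievable_gaussian {μ α β : ℝ} (h : D.Achievable μ α β) (T : ℝ) {δ : ℝ}
    (hδ : 0 < δ) (hδ1 : δ < 1)
    (hq : 0 < D.freeNulls.card * (gaussianReal 0 1).real (Set.Ici T))
    (hp : 0 < m * (gaussianReal 0 1).real (Set.Iio (T - μ))) :
    1 ≤ α * (1 + m / ((1 - δ) * (D.freeNulls.card * (gaussianReal 0 1).real (Set.Ici T))))
      + β / ((1 - δ) * (gaussianReal 0 1).real (Set.Iio (T - μ)))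
      + 1 / (δ ^ 2 * (D.freeNulls.card * (gaussianReal 0 1).real (Set.Ici T)))
      + 1 / (δ ^ 2 * (m * (gaussianReal 0 1).real (Set.Iio (T - μ)))) := by
  have h1δ : 0 < 1 - δ := by linarith
  have hm : (0 : ℝ) < m := by
    refine lt_of_le_of_ne (by positivity) fun h0 => ?_
    rw [← h0, zero_mul] at hp
    exact lt_irrefl _ hp
  have key := D.one_le_of_achievable h T (mul_pos h1δ hq) (mul_pos h1δ hp)
    (by exact_mod_cast hm)
  have e1 := D.measureReal_statLaw_nullCount_lt_le μ T hδ hq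
  have e2 := D.measureReal_statLaw_missCount_lt_le μ T hδ hp
  have e3 : β * (m / ((1 - δ) * (m * (gaussianReal 0 1).real (Set.Iio (T - μ)))))
      = β / ((1 - δ) * (gaussianReal 0 1).real (Set.Iio (T - μ))) := by
    rw [mul_left_comm (1 - δ), div_mul_cancel_left₀ hm.ne', ← div_eq_mul_inv]
  rw [e3] at key
  linarith

end GroupedDesign

/-! ### Powers of `n` and Gaussian tails on the scale `√(2 log n)`. -/

theorem tendsto_natCast_rpow_atTop {a : ℝ} (ha : 0 < a) :
    Tendsto (fun n : ℕ => (n : ℝ) ^ a) atTop atTop :=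
  (tendsto_rpow_atTop ha).comp tendsto_natCast_atTop_atTop

theorem tendsto_natCast_rpow_zero {a : ℝ} (ha : a < 0) :
    Tendsto (fun n : ℕ => (n : ℝ) ^ a) atTop (𝓝 0) := by
  have := (tendsto_rpow_neg_atTop (neg_pos.2 ha)).comp (tendsto_natCast_atTop_atTop (R := ℝ))
  simpa [Function.comp_def] using this

theorem tendsto_sqrt_two_mul_log_atTop :
    Tendsto (fun n : ℕ => √(2 * Real.log n)) atTop atTop :=
  Real.tendsto_sqrt_atTop.comp <| (tendsto_const_mul_atTop_of_pos two_pos).2 <|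
    Real.tendsto_log_atTop.comp tendsto_natCast_atTop_atTop

/-- The standard Gaussian density at `y √(2 log n)` is `n ^ (-y²) / √(2π)`. -/
theorem exp_neg_sq_mul_sqrt_log {n : ℕ} (hn : 1 ≤ n) (y : ℝ) :
    Real.exp (-((y * √(2 * Real.log n)) ^ 2) / 2) = (n : ℝ) ^ (-y ^ 2) := by
  have hn' : (1 : ℝ) ≤ n := by exact_mod_cast hn
  rw [mul_pow, Real.sq_sqrt (by positivity [Real.log_nonneg hn']),
    Real.rpow_def_of_pos (by linarith)]
  congr 1
  ring

/-- The shift by `-1` leaves room for a unit interval ending at `x √(2 log n)`, where the density is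
at least its value at that endpoint. This gives the exponent `-x²` without sharp tail asymptotics.
-/
theorem eventually_le_measureReal_gaussianReal_Ici {x : ℝ} (hx : 0 < x) :
    ∀ᶠ n : ℕ in atTop, (√(2 * Real.pi))⁻¹ * (n : ℝ) ^ (-x ^ 2)
      ≤ (gaussianReal 0 1).real (Set.Ici (x * √(2 * Real.log n) - 1)) := by
  filter_upwards [eventually_ge_atTop 1,
    (tendsto_sqrt_two_mul_log_atTop.const_mul_atTop hx).eventually_ge_atTop 1] with n hn hn2
  rw [← exp_neg_sq_mul_sqrt_log hn]
  refine (le_measureReal_gaussianReal_Ico (a := x * √(2 * Real.log n) - 1)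
    (by linarith) (by linarith)).trans ?_
  exact measureReal_mono Set.Ico_subset_Ici_self

/-- The unit interval starting at `-y √(2 log n)` eventually fits below the threshold because `y + d
> 0`. Here `d` stands for `x - √r`, of either sign. -/
theorem eventually_le_measureReal_gaussianReal_Iio {y d : ℝ} (hy : 0 < y) (hd : -d < y) :
    ∀ᶠ n : ℕ in atTop, (√(2 * Real.pi))⁻¹ * (n : ℝ) ^ (-y ^ 2)
      ≤ (gaussianReal 0 1).real (Set.Iio (d * √(2 * Real.log n) - 1)) := by
  filter_upwards [eventually_ge_atTop 1,
    (tendsto_sqrt_two_mul_log_atTop.const_mul_atTop hy).eventually_ge_atTop 1,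
    (tendsto_sqrt_two_mul_log_atTop.const_mul_atTop
      (show 0 < y + d by linarith)).eventually_ge_atTop 2] with n hn hn2 hn3
  rw [← exp_neg_sq_mul_sqrt_log hn]
  refine (le_measureReal_gaussianReal_Ico (a := -(y * √(2 * Real.log n)))
    le_rfl (by linarith)).trans ?_
  refine measureReal_mono fun z hz => ?_
  have := hz.2
  rw [Set.mem_Iio]
  linarith

theorem tendsto_measureReal_gaussianReal_Iio {d : ℝ} (hd : 0 < d) :
    Tendsto (fun n : ℕ => (gaussianReal 0 1).real (Set.Iio (d * √(2 * Real.log n) - 1)))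
      atTop (𝓝 1) := by
  have hlim : Tendsto (fun n : ℕ => d * √(2 * Real.log n) - 2) atTop atTop :=
    tendsto_atTop_add_const_right _ (-2) (tendsto_sqrt_two_mul_log_atTop.const_mul_atTop hd)
  refine tendsto_of_tendsto_of_tendsto_of_le_of_le
    ((tendsto_cdf_atTop (gaussianReal 0 1)).comp hlim) tendsto_const_nhds (fun n => ?_)
    fun n => measureReal_le_one
  simp only [Function.comp, cdf_eq_real]
  refine measureReal_mono fun z hz => ?_
  have := Set.mem_Iic.1 hz
  rw [Set.mem_Iio]
  linarith

/-! ### Sizes of the signal set and of the free nulls. -/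

section Sizes

variable {s t : ℝ} {m A : ℕ → ℕ}

theorem eventually_signalCount_le (hs : s < 1)
    (hm : ∀ n : ℕ, 1 ≤ n → |(m n : ℝ) - (n : ℝ) ^ (1 - s)| < 1) :
    ∀ᶠ n : ℕ in atTop, (m n : ℝ) ≤ 2 * (n : ℝ) ^ (1 - s) := by
  filter_upwards [eventually_ge_atTop 1,
    (tendsto_natCast_rpow_atTop (sub_pos.2 hs)).eventually_ge_atTop 1] with n hn h1
  linarith [(abs_lt.1 (hm n hn)).2]

theorem eventually_le_signalCount (hs : s < 1)
    (hm : ∀ n : ℕ, 1 ≤ n → |(m n : ℝ) - (n : ℝ) ^ (1 - s)| < 1) :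
    ∀ᶠ n : ℕ in atTop, (n : ℝ) ^ (1 - s) / 2 ≤ m n := by
  filter_upwards [eventually_ge_atTop 1,
    (tendsto_natCast_rpow_atTop (sub_pos.2 hs)).eventually_ge_atTop 2] with n hn h1
  linarith [(abs_lt.1 (hm n hn)).1]

/-- Signals and grouped nulls number `m (1 + A)`, of order at most `n ^ (1 - s + t) = o(n)`. -/
theorem eventually_half_le_freeNullCount (ht : 0 ≤ t) (hts : t < s) (hs : s < 1)
    (hm : ∀ n : ℕ, 1 ≤ n → |(m n : ℝ) - (n : ℝ) ^ (1 - s)| < 1)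
    (hA : ∀ n : ℕ, 1 ≤ n → |(A n : ℝ) - ((n : ℝ) - m n) / (n : ℝ) ^ (1 - t)| < 1) :
    ∀ᶠ n : ℕ in atTop, (n : ℝ) / 2 ≤ (n - m n - m n * A n : ℕ) := by
  -- The `12` comes from `m (1 + A) ≤ 2 n ^ (1 - s) * 3 n ^ t = 6 n / n ^ (s - t)`, which must be at
  -- most `n / 2`.
  filter_upwards [eventually_ge_atTop 1, eventually_signalCount_le hs hm,
    (tendsto_natCast_rpow_atTop (sub_pos.2 hts)).eventually_ge_atTop 12] with n hn h1 h2
  have hn' : (1 : ℝ) ≤ n := by exact_mod_cast hn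
  have hn0 : (0 : ℝ) < n := by linarith
  have ht1 : (1 : ℝ) ≤ (n : ℝ) ^ t := Real.one_le_rpow hn' ht
  have hAle : (A n : ℝ) ≤ 2 * (n : ℝ) ^ t := by
    have hdiv : ((n : ℝ) - m n) / (n : ℝ) ^ (1 - t) ≤ (n : ℝ) ^ t := by
      rw [div_le_iff₀ (by positivity), ← Real.rpow_add hn0]
      simp
    linarith [(abs_lt.1 (hA n hn)).2]
  have hmA : (m n : ℝ) + m n * A n ≤ n / 2 := by
    calc (m n : ℝ) + m n * A n ≤ m n * (3 * (n : ℝ) ^ t) := by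
          have := mul_le_mul_of_nonneg_left (show 1 + (A n : ℝ) ≤ 3 * (n : ℝ) ^ t by linarith)
            (Nat.cast_nonneg (α := ℝ) (m n))
          linarith
      _ ≤ 2 * (n : ℝ) ^ (1 - s) * (3 * (n : ℝ) ^ t) := by gcongr
      _ = 6 * (n : ℝ) / (n : ℝ) ^ (s - t) := by
          rw [eq_div_iff (by positivity)]
          have : (n : ℝ) ^ (1 - s) * (n : ℝ) ^ t * (n : ℝ) ^ (s - t) = n := by
            rw [← Real.rpow_add hn0, ← Real.rpow_add hn0]
            simp
          linear_combination 6 * this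
      _ ≤ 6 * (n : ℝ) / 12 := by gcongr
      _ = n / 2 := by ring
  have hle : m n + m n * A n ≤ n := by
    have : (m n : ℝ) + m n * A n ≤ n := by linarith
    exact_mod_cast this
  rw [Nat.sub_sub, Nat.cast_sub hle]
  push_cast
  linarith

end Sizes

/-! ### Passage to the limit and choice of exponents. -/

/-- The limiting form of `GroupedDesign.one_le_of_achievable_gaussian` at the thresholds
`x √(2 log n) - 1`. -/
theorem one_le_limit_of_achievable {s t x δ Lα Lβ : ℝ} (ht : 0 ≤ t) (hts : t < s) (hs : s < 1)
    (hx : 0 < x) (hx1 : x < 1) (hδ : 0 < δ) (hδ1 : δ < 1) {m A : ℕ → ℕ}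
    (hm : ∀ n : ℕ, 1 ≤ n → |(m n : ℝ) - (n : ℝ) ^ (1 - s)| < 1)
    (hA : ∀ n : ℕ, 1 ≤ n → |(A n : ℝ) - ((n : ℝ) - m n) / (n : ℝ) ^ (1 - t)| < 1)
    {μ α β p : ℕ → ℝ} (hα0 : ∀ n, 0 ≤ α n)
    (hp : ∀ n : ℕ, p n = (gaussianReal 0 1).real (Set.Iio (x * √(2 * Real.log n) - 1 - μ n)))
    (hach : ∀ᶠ n : ℕ in atTop, ∃ D : GroupedDesign n (m n) (A n),
      D.Achievable (μ n) (α n) (β n))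
    (hα : Tendsto α atTop (𝓝 Lα))
    (hαx : Tendsto (fun n : ℕ => α n * (n : ℝ) ^ (x ^ 2 - s)) atTop (𝓝 0))
    (hβ : Tendsto (fun n => β n / p n) atTop (𝓝 Lβ))
    (hmp : Tendsto (fun n => m n * p n) atTop atTop) :
    1 ≤ Lα + Lβ / (1 - δ) := by
  have h1δ : 0 < 1 - δ := by linarith
  set κ : ℝ := (√(2 * Real.pi))⁻¹
  have hκ : 0 < κ := by positivity
  set Uq : ℕ → ℝ := fun n => ((n - m n - m n * A n : ℕ) : ℝ)
    * (gaussianReal 0 1).real (Set.Ici (x * √(2 * Real.log n) - 1))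
  have hUq : ∀ᶠ n : ℕ in atTop, κ / 2 * (n : ℝ) ^ (1 - x ^ 2) ≤ Uq n := by
    filter_upwards [eventually_ge_atTop 1, eventually_half_le_freeNullCount ht hts hs hm hA,
      eventually_le_measureReal_gaussianReal_Ici hx] with n hn h1 h2
    have hn0 : (0 : ℝ) < n := by exact_mod_cast hn
    calc κ / 2 * (n : ℝ) ^ (1 - x ^ 2) = (n / 2) * (κ * (n : ℝ) ^ (-x ^ 2)) := by
          rw [sub_eq_add_neg, Real.rpow_add hn0, Real.rpow_one]
          ring
      _ ≤ Uq n := mul_le_mul h1 h2 (by positivity) (by positivity)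
  have hUq_top : Tendsto Uq atTop atTop :=
    tendsto_atTop_mono' _ hUq <| (tendsto_natCast_rpow_atTop
      (show 0 < 1 - x ^ 2 by nlinarith)).const_mul_atTop (by positivity)
  have hratio : Tendsto (fun n => α n * (m n / ((1 - δ) * Uq n))) atTop (𝓝 0) := by
    have hup : Tendsto (fun n : ℕ => 4 / ((1 - δ) * κ) * (α n * (n : ℝ) ^ (x ^ 2 - s)))
        atTop (𝓝 0) := by simpa using hαx.const_mul (4 / ((1 - δ) * κ))
    refine squeeze_zero' ?_ ?_ hup
    · filter_upwards [hUq_top.eventually_ge_atTop 0] with n hn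
      have := hα0 n
      positivity
    · filter_upwards [eventually_ge_atTop 1, hUq, eventually_signalCount_le hs hm]
        with n hn h1 h2
      have hn0 : (0 : ℝ) < n := by exact_mod_cast hn
      have := hα0 n
      calc α n * (m n / ((1 - δ) * Uq n))
          ≤ α n * (2 * (n : ℝ) ^ (1 - s) / ((1 - δ) * (κ / 2 * (n : ℝ) ^ (1 - x ^ 2)))) := by
            gcongr
        _ = 4 / ((1 - δ) * κ) * (α n * ((n : ℝ) ^ (1 - s) / (n : ℝ) ^ (1 - x ^ 2))) := by
            field_simp
            ring
        _ = 4 / ((1 - δ) * κ) * (α n * (n : ℝ) ^ (x ^ 2 - s)) := by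
            rw [← Real.rpow_sub hn0]
            ring_nf
  have hinv : ∀ {f : ℕ → ℝ}, Tendsto f atTop atTop →
      Tendsto (fun n => 1 / (δ ^ 2 * f n)) atTop (𝓝 0) := fun hf => by
    simp only [one_div]
    exact (hf.const_mul_atTop (show 0 < δ ^ 2 by positivity)).inv_tendsto_atTop
  have hlim : Tendsto (fun n => (α n + α n * (m n / ((1 - δ) * Uq n))) + β n / p n / (1 - δ)
      + 1 / (δ ^ 2 * Uq n) + 1 / (δ ^ 2 * (m n * p n))) atTop
      (𝓝 (Lα + 0 + Lβ / (1 - δ) + 0 + 0)) :=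
    ((((hα.add hratio).add (hβ.div_const _)).add (hinv hUq_top)).add (hinv hmp))
  have hge : 1 ≤ Lα + 0 + Lβ / (1 - δ) + 0 + 0 := by
    refine ge_of_tendsto hlim ?_
    filter_upwards [hach, hUq_top.eventually_gt_atTop 0, hmp.eventually_gt_atTop 0]
      with n hD h1 h2
    obtain ⟨D, hD⟩ := hD
    rw [hp] at h2
    have key := D.one_le_of_achievable_gaussian hD (x * √(2 * Real.log n) - 1) hδ hδ1
      (by rw [D.card_freeNulls]; exact h1) h2
    rw [D.card_freeNulls, ← hp] at key
    rw [div_div, mul_comm (p n)]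
    change 1 ≤ α n * (1 + m n / ((1 - δ) * Uq n)) + _ + 1 / (δ ^ 2 * Uq n) + _ at key
    linarith
  linarith

/-- The strict bound `l < 1` survives in the limit because for `κ = 0` the sequence is the constant
`c`. -/
theorem tendsto_const_mul_rpow_of_lt_one {c κ : ℝ} (hc : 0 < c)
    (h : ∀ᶠ n : ℕ in atTop, c * (n : ℝ) ^ (-κ) < 1) :
    0 ≤ κ ∧ ∃ l < 1, Tendsto (fun n : ℕ => c * (n : ℝ) ^ (-κ)) atTop (𝓝 l) := by
  rcases lt_trichotomy κ 0 with hκ | rfl | hκ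
  · have := (tendsto_natCast_rpow_atTop (neg_pos.2 hκ)).const_mul_atTop hc
    obtain ⟨n, h1, h2⟩ := (h.and (this.eventually_ge_atTop 1)).exists
    linarith
  · obtain ⟨n, hn⟩ := h.exists
    exact ⟨le_rfl, c, by simpa using hn, by simp⟩
  · refine ⟨hκ.le, 0, zero_lt_one, ?_⟩
    simpa using (tendsto_natCast_rpow_zero (neg_lt_zero.2 hκ)).const_mul c

theorem mainTheorem5 (s t r : ℝ) (ht : 0 ≤ t) (hts : t < s) (hsr : s < r) (hr : r < 1)
    (m A : ℕ → ℕ)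
    (hm : ∀ n : ℕ, 1 ≤ n → |(m n : ℝ) - (n : ℝ) ^ (1 - s)| < 1)
    (hA : ∀ n : ℕ, 1 ≤ n → |(A n : ℝ) - ((n : ℝ) - m n) / (n : ℝ) ^ (1 - t)| < 1)
    (c κα κβ : ℝ) (hc : 0 < c)
    (hlt : ∀ᶠ n : ℕ in Filter.atTop, c * (n : ℝ) ^ (-κα) < 1 ∧ c * (n : ℝ) ^ (-κβ) < 1)
    (hach : ∀ᶠ n : ℕ in Filter.atTop, ∃ D : GroupedDesign n (m n) (A n),
      D.Achievable (Real.sqrt (2 * r * Real.log n)) (c * (n : ℝ) ^ (-κα)) (c * (n : ℝ) ^ (-κβ))) :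
    Real.sqrt (s + κα) + Real.sqrt κβ ≤ Real.sqrt r := by
  have hs0 : 0 < s := by linarith
  have hs1 : s < 1 := by linarith
  have hr0 : 0 < r := by linarith
  obtain ⟨hκα, Lα, hLα, hα⟩ := tendsto_const_mul_rpow_of_lt_one hc (hlt.mono fun _ h => h.1)
  obtain ⟨hκβ, Lβ, hLβ, hβ⟩ := tendsto_const_mul_rpow_of_lt_one hc (hlt.mono fun _ h => h.2)
  have hsr1 : √r < 1 := (Real.sqrt_lt' one_pos).2 (by simpa using hr)
  have hsr0 : 0 < √r := Real.sqrt_pos.2 hr0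
  have hα0 : ∀ n : ℕ, 0 ≤ c * (n : ℝ) ^ (-κα) := fun n => by positivity
  have hαx : ∀ {x : ℝ}, 0 < x → x < √(s + κα) →
      Tendsto (fun n : ℕ => c * (n : ℝ) ^ (-κα) * (n : ℝ) ^ (x ^ 2 - s)) atTop (𝓝 0) := by
    intro x hx0 hx
    have hx2 : x ^ 2 < s + κα := (Real.lt_sqrt hx0.le).1 hx
    have h0 := (tendsto_natCast_rpow_zero (show x ^ 2 - s - κα < 0 by linarith)).const_mul c
    rw [mul_zero] at h0
    refine h0.congr' ?_
    filter_upwards [eventually_ge_atTop 1] with n hn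
    have hn0 : (0 : ℝ) < n := by exact_mod_cast hn
    rw [mul_assoc, ← Real.rpow_add hn0]
    ring_nf
  have hp : ∀ (x : ℝ) (n : ℕ),
      (gaussianReal 0 1).real (Set.Iio ((x - √r) * √(2 * Real.log n) - 1))
        = (gaussianReal 0 1).real
          (Set.Iio (x * √(2 * Real.log n) - 1 - √(2 * r * Real.log n))) := by
    intro x n
    rw [mul_comm 2 r, mul_assoc, Real.sqrt_mul hr0.le]
    ring_nf
  by_contra! hcon
  rcases hκβ.eq_or_lt with rfl | hκβ
  · rw [Real.sqrt_zero, add_zero] at hcon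
    -- `x > √r` puts the threshold far above the signal mean, `x < √(s + κα)` keeps false
    -- discoveries costly, and `x < 1` makes the free null count diverge.
    obtain ⟨x, hx1, hx2⟩ := exists_between (lt_min hcon hsr1)
    obtain ⟨hx2, hx3⟩ := lt_min_iff.1 hx2
    have hx0 : 0 < x := hsr0.trans hx1
    have hκα : 0 < κα := by
      have := (Real.sqrt_lt_sqrt_iff hr0.le).1 hcon
      linarith
    have hc1 : c < 1 := by
      obtain ⟨n, hn⟩ := hlt.exists
      simpa using hn.2
    have hαlim : Tendsto (fun n : ℕ => c * (n : ℝ) ^ (-κα)) atTop (𝓝 0) := by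
      simpa using (tendsto_natCast_rpow_zero (neg_lt_zero.2 hκα)).const_mul c
    have hplim := tendsto_measureReal_gaussianReal_Iio (sub_pos.2 hx1)
    have hβp : Tendsto (fun n : ℕ => c * (n : ℝ) ^ (-(0 : ℝ))
        / (gaussianReal 0 1).real (Set.Iio ((x - √r) * √(2 * Real.log n) - 1)))
        atTop (𝓝 c) := by
      simpa [Pi.div_def] using (tendsto_const_nhds (x := c)).div hplim one_ne_zero
    have hm_top : Tendsto (fun n => (m n : ℝ)) atTop atTop :=
      tendsto_atTop_mono' _ (eventually_le_signalCount hs1 hm)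
        ((tendsto_natCast_rpow_atTop (sub_pos.2 hs1)).atTop_div_const two_pos)
    -- This `δ` gives `c / (1 - δ) = 2 c / (1 + c) < 1`.
    have key := one_le_limit_of_achievable (δ := (1 - c) / 2) ht hts hs1 hx0 hx3 (by linarith)
      (by linarith) hm hA hα0 (hp x) hach hαlim (hαx hx0 hx2) hβp
      (hm_top.atTop_mul_pos one_pos hplim)
    rw [zero_add, one_le_div (by linarith)] at key
    linarith
  · have hb0 : 0 < √κβ := Real.sqrt_pos.2 hκβ
    have hs0' : 0 < √(1 - s) := Real.sqrt_pos.2 (by linarith)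
    have hM0 : 0 < √(s + κα) := Real.sqrt_pos.2 (by linarith)
    -- From `√s + √(1 - s) ≥ 1 > √r`; it lets `x` exceed `√r - √(1 - s)`, leaving room for a `y`
    -- below `√(1 - s)`.
    have hsum : √r - √(1 - s) < √(s + κα) := by
      have h1 : √s ≤ √(s + κα) := Real.sqrt_le_sqrt (by linarith)
      have h2 : 1 ≤ √s + √(1 - s) := by
        have e1 := Real.sq_sqrt hs0.le
        have e2 := Real.sq_sqrt (sub_pos.2 hs1).le
        nlinarith [Real.sqrt_nonneg s, mul_nonneg (Real.sqrt_nonneg s) hs0'.le]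
      linarith
    obtain ⟨x, hx, hxM⟩ := exists_between
      (show max 0 (max (√r - √κβ) (√r - √(1 - s))) < min 1 (√(s + κα)) by
        simp only [max_lt_iff, lt_min_iff]
        refine ⟨⟨one_pos, ?_, ?_⟩, hM0, ?_, hsum⟩ <;> linarith)
    simp only [max_lt_iff] at hx
    obtain ⟨hx0, hxκ, hxs⟩ := hx
    obtain ⟨hx1, hxM⟩ := lt_min_iff.1 hxM
    -- `y > √r - x` validates the tail bound, `y < √κβ` sends `β / p` to zero, and `y < √(1 - s)`
    -- makes the expected number of missed signals diverge.
    obtain ⟨y, hy, hyB⟩ := exists_between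
      (show max 0 (√r - x) < min (√κβ) (√(1 - s)) by
        simp only [max_lt_iff, lt_min_iff]
        refine ⟨⟨hb0, ?_⟩, hs0', ?_⟩ <;> linarith)
    obtain ⟨hy0, hyx⟩ := max_lt_iff.1 hy
    obtain ⟨hyκ, hys⟩ := lt_min_iff.1 hyB
    have hyκ2 : y ^ 2 < κβ := (Real.lt_sqrt hy0.le).1 hyκ
    have hys2 : y ^ 2 < 1 - s := (Real.lt_sqrt hy0.le).1 hys
    have hple := eventually_le_measureReal_gaussianReal_Iio (d := x - √r) hy0 (by linarith)
    set g : ℝ := (√(2 * Real.pi))⁻¹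
    have hg : 0 < g := by positivity
    have hβp : Tendsto (fun n : ℕ => c * (n : ℝ) ^ (-κβ)
        / (gaussianReal 0 1).real (Set.Iio ((x - √r) * √(2 * Real.log n) - 1)))
        atTop (𝓝 0) := by
      have hup : Tendsto (fun n : ℕ => c / g * (n : ℝ) ^ (y ^ 2 - κβ)) atTop (𝓝 0) := by
        simpa using (tendsto_natCast_rpow_zero (sub_neg.2 hyκ2)).const_mul (c / g)
      refine squeeze_zero' (Eventually.of_forall fun n => by positivity) ?_ hup
      filter_upwards [eventually_ge_atTop 1, hple] with n hn h1
      have hn0 : (0 : ℝ) < n := by exact_mod_cast hn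
      refine (div_le_div_of_nonneg_left (by positivity) (by positivity) h1).trans (le_of_eq ?_)
      rw [mul_div_mul_comm, ← Real.rpow_sub hn0]
      ring_nf
    have hmp : Tendsto (fun n : ℕ => (m n : ℝ)
        * (gaussianReal 0 1).real (Set.Iio ((x - √r) * √(2 * Real.log n) - 1)))
        atTop atTop := by
      refine tendsto_atTop_mono' _ ?_ ((tendsto_natCast_rpow_atTop
        (sub_pos.2 hys2)).const_mul_atTop (show 0 < g / 2 by positivity))
      filter_upwards [eventually_ge_atTop 1, hple, eventually_le_signalCount hs1 hm]
        with n hn h1 h2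
      have hn0 : (0 : ℝ) < n := by exact_mod_cast hn
      calc g / 2 * (n : ℝ) ^ (1 - s - y ^ 2)
          = (n : ℝ) ^ (1 - s) / 2 * (g * (n : ℝ) ^ (-y ^ 2)) := by
            rw [sub_eq_add_neg (1 - s), Real.rpow_add hn0]
            ring
        _ ≤ _ := mul_le_mul h2 h1 (by positivity) (by positivity)
    -- Any `δ` in `(0, 1)` would do, as the limit of `β / p` is zero; what remains is `1 ≤ Lα`.
    have key := one_le_limit_of_achievable (δ := 1 / 2) ht hts hs1 hx0 hx1 (by norm_num)
      (by norm_num) hm hA hα0 (hp x) hach hα (hαx hx0 hxM) hβp hmp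
    rw [zero_div, add_zero] at key
    linarith
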